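/- For $\tau\in\mathbb H$ put $q=e^{2\pi i\tau}$, let $\eta(\tau)=e^{\pi i\tau/12}\prod_{n\ge1}(1-q^n)$ be the Dedekind eta function, and let \[ \Phi_2(q)=\frac{\eta(2\tau)}{\eta(\tau)^2},\qquad G_2(q)=\left(\frac{\eta(2\tau)}{\eta(\tau)}\right)^{24},\qquad G_8(q)=\frac{\eta(8\tau)^4\,\eta(2\tau)^2}{\eta(4\tau)^2\,\eta(\tau)^4}. \] Each of these functions has an expansion in non-negative powers of $q$ that converges for all $\tau\in\mathbb H$; denote by $\Phi_2,G_2,G_8\in\mathbb C[[q]]$ also the corresponding power series, and for a power series $f=\sum_{n\ge0}a(n)q^n$ let $f|U_2=\sum_{n\ge0}a(2n)q^n$. Then \begin{align*} G_8(q)|U_2 &= 4G_8(q)+16G_8(q)^2,\\ \Phi_2(-q)|U_2 &= (1+4G_8(q))\,\Phi_2(-q^2),\\ (\Phi_2(-q)G_8(q))|U_2 &= (2G_8(q)+8G_8(q)^2)\,\Phi_2(-q^2),\\ (\Phi_2(-q)G_2(-q))|U_2 &= P(G_8(q))\,\Phi_2(-q^2), \end{align*} where $P$ is the polynomial \begin{align*}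 P(x)={}&2\cdot13\,x+2^3\cdot403\,x^2+2^6\cdot2015\,x^3+2^{10}\cdot2431\,x^4+2^{15}\cdot819\,x^5\\ &+2^{19}\cdot325\,x^6+2^{22}\cdot151\,x^7+2^{26}\cdot19\,x^8+2^{30}x^9. \end{align*} -/

import Mathlib

noncomputable section

namespace OverpartitionU2

open ModularForm (eta)
open scoped UpperHalfPlane

/-- The eta-quotient `φ₂(τ) = η(2τ) / η(τ)²` on the upper half-plane. -/
def phi2 (τ : ℍ) : ℂ := eta (2 * τ) / eta τ ^ 2

/-- The eta-quotient `g₂(τ) = (η(2τ) / η(τ))²⁴` on the upper half-plane. -/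
def g2 (τ : ℍ) : ℂ := (eta (2 * τ) / eta τ) ^ 24

/-- The eta-quotient `g₈(τ) = η(8τ)⁴ η(2τ)² / (η(4τ)² η(τ)⁴)` on the upper half-plane. -/
def g8 (τ : ℍ) : ℂ :=
  eta (8 * τ) ^ 4 * eta (2 * τ) ^ 2 / (eta (4 * τ) ^ 2 * eta τ ^ 4)

/-- `Φ₂(q)`: the expansion of `φ₂(τ)` in powers of `q = exp(2πiτ)`. -/
def Phi2 : PowerSeries ℂ := UpperHalfPlane.qExpansion 1 phi2

/-- `G₂(q)`: the expansion of `g₂(τ)` in powers of `q = exp(2πiτ)`. -/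
def G2 : PowerSeries ℂ := UpperHalfPlane.qExpansion 1 g2

/-- `G₈(q)`: the expansion of `g₈(τ)` in powers of `q = exp(2πiτ)`. -/
def G8 : PowerSeries ℂ := UpperHalfPlane.qExpansion 1 g8

/-- Atkin's operator `U_p`: it sends `∑ a(n) qⁿ` to `∑ a(pn) qⁿ`. -/
def atkinU (p : ℕ) (f : PowerSeries ℂ) : PowerSeries ℂ :=
  PowerSeries.mk fun n => PowerSeries.coeff (p * n) f

/-- The substitution `f(q) ↦ f(-q)`. -/
def substNeg (f : PowerSeries ℂ) : PowerSeries ℂ := PowerSeries.evalNegHom f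

/-- The substitution `f(q) ↦ f(q²)`. -/
def substSq (f : PowerSeries ℂ) : PowerSeries ℂ := PowerSeries.expand 2 two_ne_zero f

open Polynomial in
/-- The polynomial of degree nine that occurs in the action of `U₂` on `Φ₂(-q) G₂(-q)`. -/
def P : ℤ[X] :=
  C (2 * 13) * X + C (2 ^ 3 * 403) * X ^ 2 + C (2 ^ 6 * 2015) * X ^ 3
    + C (2 ^ 10 * 2431) * X ^ 4 + C (2 ^ 15 * 819) * X ^ 5 + C (2 ^ 19 * 325) * X ^ 6
    + C (2 ^ 22 * 151) * X ^ 7 + C (2 ^ 26 * 19) * X ^ 8 + C (2 ^ 30) * X ^ 9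

/-- The power series `F` converges to `f(τ)` at `q = exp(2πiτ)`, for every `τ` in the upper
half-plane. -/
def IsQSeriesOf (F : PowerSeries ℂ) (f : ℍ → ℂ) : Prop :=
  ∀ τ : ℍ, HasSum
    (fun n : ℕ => PowerSeries.coeff n F * Complex.exp (2 * Real.pi * Complex.I * τ) ^ n) (f τ)

end OverpartitionU2

end

namespace OverpartitionU2

open Filter Topology Finset

/-! Everything reduces to rational functions of a = φ(z) and b = φ(-z), where φ(z) = ∑ z^(m²) over
the integers m. On the unit disc Φ₂ is 1/b, G₈ is (a² - b²)/(8b²) and G₂ is a⁴(a⁴ - b⁴)/(16b⁸). If F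
has sum f, then F|U₂ at z² is the even part (f(z) + f(-z))/2, and z ↦ -z swaps a and b. On the other
side G₈(z²) = (a - b)²/(16ab) and Φ₂(-z⁴) = 2/(a + b). Each formula is then an identity of rational
functions in a and b, and uniqueness of power series carries it back to formal series. The theta
identities behind this dictionary are a + b = 2φ(z⁴), ab = φ(-z²)², a² + b² = 2φ(z²)² and a² - b² =
8zψ(z⁴)². The second is a product manipulation; the first comes from the 2-dissection of φ, hence
from Jacobi's triple product; the third follows from these two by a functional equation
(`phi_sq_add_phi_neg_sq`); the fourth combines the dissection with φ(z)ψ(z²) = ψ(z)². -/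

/-! ### Gaussian binomials and the finite triple product -/

/-- The finite `q`-Pochhammer symbol `∏ (1 - q ^ i)`, `1 ≤ i ≤ n`. -/
noncomputable def qPoch (q : ℂ) (n : ℕ) : ℂ := ∏ i ∈ range n, (1 - q ^ (i + 1))

/-- Euler's product `∏ (1 - q ^ n)`, `n ≥ 1`. -/
noncomputable def euler (q : ℂ) : ℂ := ∏' n : ℕ, (1 - q ^ (n + 1))

/-- The Gaussian binomial coefficients. -/
noncomputable def qBinom (q : ℂ) : ℕ → ℕ → ℂ
  | _, 0 => 1
  | 0, _ + 1 => 0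
  | n + 1, k + 1 => q ^ (k + 1) * qBinom q n (k + 1) + qBinom q n k

lemma qBinom_zero_right (q : ℂ) (n : ℕ) : qBinom q n 0 = 1 := by cases n <;> simp [qBinom]

lemma qBinom_succ_succ (q : ℂ) (n k : ℕ) :
    qBinom q (n + 1) (k + 1) = q ^ (k + 1) * qBinom q n (k + 1) + qBinom q n k := by
  simp [qBinom]

lemma qBinom_eq_zero (q : ℂ) {n k : ℕ} (h : n < k) : qBinom q n k = 0 := by
  induction n generalizing k with
  | zero => obtain _ | k := k <;> simp_all [qBinom]
  | succ n ih =>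
    obtain _ | k := k
    · omega
    · rw [qBinom_succ_succ, ih (by omega), ih (by omega)]; simp

lemma qPoch_succ (q : ℂ) (n : ℕ) : qPoch q (n + 1) = qPoch q n * (1 - q ^ (n + 1)) :=
  prod_range_succ _ _

lemma qBinom_self (q : ℂ) (n : ℕ) : qBinom q n n = 1 := by
  induction n with
  | zero => simp [qBinom]
  | succ n ih => rw [qBinom_succ_succ, ih, qBinom_eq_zero q (Nat.lt_succ_self n)]; simp

lemma qBinom_add_mul (q : ℂ) (j k : ℕ) :
    qBinom q (j + k) k * (qPoch q j * qPoch q k) = qPoch q (j + k) := by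
  induction k generalizing j with
  | zero => simp [qBinom_zero_right, qPoch]
  | succ k ihk =>
    induction j with
    | zero => simp [qBinom_self, qPoch]
    | succ j ihj =>
      have h1 := ihk (j + 1)
      rw [show j + 1 + (k + 1) = (j + k + 1) + 1 by ring, qBinom_succ_succ, qPoch_succ q (j + k + 1)]
      rw [show j + (k + 1) = j + k + 1 by ring] at ihj
      rw [show j + 1 + k = j + k + 1 by ring] at h1
      have e1 := qPoch_succ q j
      have e2 := qPoch_succ q k
      -- The recursion matches the splitting 1 - q^(j+k+2) = q^(k+1)(1 - q^(j+1)) + (1 - q^(k+1)).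
      calc _ = q ^ (k + 1) * (1 - q ^ (j + 1)) *
              (qBinom q (j + k + 1) (k + 1) * (qPoch q j * qPoch q (k + 1)))
            + (1 - q ^ (k + 1)) *
              (qBinom q (j + k + 1) k * (qPoch q (j + 1) * qPoch q k)) := by
            rw [e1, e2]; ring
        _ = _ := by rw [ihj, h1]; ring

/-- The `q`-binomial theorem. -/
lemma prod_one_add_mul_pow (s y : ℂ) (N : ℕ) :
    ∏ i ∈ range N, (1 + y * s ^ (2 * i + 1)) =
      ∑ k ∈ range (N + 1), s ^ (k ^ 2) * qBinom (s ^ 2) N k * y ^ k := by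
  induction N generalizing y with
  | zero => simp [qBinom]
  | succ N ih =>
    rw [prod_range_succ', sum_range_succ']
    have h : ∏ i ∈ range N, (1 + y * s ^ (2 * (i + 1) + 1)) =
        ∏ i ∈ range N, (1 + (y * s ^ 2) * s ^ (2 * i + 1)) :=
      prod_congr rfl fun i _ => by ring
    rw [h, ih]
    have h2 : ∑ k ∈ range (N + 1), s ^ ((k + 1) ^ 2) * qBinom (s ^ 2) (N + 1) (k + 1) * y ^ (k + 1)
        = ∑ k ∈ range (N + 1),
            s ^ ((k + 1) ^ 2) * qBinom (s ^ 2) N (k + 1) * (y * s ^ 2) ^ (k + 1)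
          + y * s * ∑ k ∈ range (N + 1), s ^ (k ^ 2) * qBinom (s ^ 2) N k * (y * s ^ 2) ^ k := by
      rw [mul_sum, ← sum_add_distrib]
      refine sum_congr rfl fun k _ => ?_
      rw [qBinom_succ_succ]
      ring
    have h3 := sum_range_succ' (fun k => s ^ (k ^ 2) * qBinom (s ^ 2) N k * (y * s ^ 2) ^ k) (N + 1)
    rw [sum_range_succ, qBinom_eq_zero _ (Nat.lt_succ_self N)] at h3
    simp only [qBinom_zero_right] at h3 ⊢
    rw [h2]
    linear_combination h3

/-- The finite form of the triple product identity. -/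
lemma prod_mul_prod_eq_sum_qBinom {s w : ℂ} (hs : s ≠ 0) (hw : w ≠ 0) (n : ℕ) :
    (∏ i ∈ range n, (1 + w * s ^ (2 * i + 1))) * ∏ i ∈ range n, (1 + w⁻¹ * s ^ (2 * i + 1)) =
      ∑ k ∈ range (2 * n + 1),
        qBinom (s ^ 2) (2 * n) k * (s ^ (((k : ℤ) - n) ^ 2) * w ^ ((k : ℤ) - n)) := by
  -- The shift y = w s^(-2n) centres the 2n factors: the upper n give the product in w, and the
  -- lower n, reversed and divided by w s^(-(2i+1)) each, give the product in w⁻¹.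
  have key := prod_one_add_mul_pow s (w * (s ^ (2 * n))⁻¹) (2 * n)
  have hsq : ∀ n : ℕ, ∏ i ∈ range n, s ^ (2 * i + 1) = s ^ (n ^ 2) := by
    intro n
    induction n with
    | zero => simp
    | succ n ih => rw [prod_range_succ, ih]; ring
  have hlow : w⁻¹ ^ n * s ^ (n ^ 2) *
        ∏ i ∈ range n, (1 + w * (s ^ (2 * n))⁻¹ * s ^ (2 * i + 1)) =
      ∏ i ∈ range n, (1 + w⁻¹ * s ^ (2 * i + 1)) := by
    rw [← prod_range_reflect (fun i => 1 + w * (s ^ (2 * n))⁻¹ * s ^ (2 * i + 1)), ← hsq n]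
    have : w⁻¹ ^ n = ∏ i ∈ range n, w⁻¹ := by simp
    rw [this, ← prod_mul_distrib, ← prod_mul_distrib]
    refine prod_congr rfl fun i hi => ?_
    have hi := mem_range.1 hi
    have e : s ^ (2 * n) = s ^ (2 * (n - 1 - i) + 1) * s ^ (2 * i + 1) := by
      rw [← pow_add]; congr 1; omega
    rw [e]
    field_simp
    ring
  rw [two_mul n, prod_range_add, ← two_mul n] at key
  have hup : ∏ i ∈ range n, (1 + w * (s ^ (2 * n))⁻¹ * s ^ (2 * (n + i) + 1)) =
      ∏ i ∈ range n, (1 + w * s ^ (2 * i + 1)) := by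
    refine prod_congr rfl fun i _ => ?_
    rw [show 2 * (n + i) + 1 = 2 * n + (2 * i + 1) by ring, pow_add]
    field_simp
  rw [hup] at key
  rw [← hlow]
  calc _ = w⁻¹ ^ n * s ^ (n ^ 2) * ((∏ i ∈ range n, (1 + w * (s ^ (2 * n))⁻¹ * s ^ (2 * i + 1))) *
        ∏ i ∈ range n, (1 + w * s ^ (2 * i + 1))) := by ring
    _ = _ := by
      rw [key, mul_sum]
      refine sum_congr rfl fun k _ => ?_
      have e : s ^ (((k : ℤ) - n) ^ 2) = s ^ (k ^ 2) * s ^ (n ^ 2) * ((s ^ (2 * n))⁻¹) ^ k := by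
        rw [show ((k : ℤ) - n) ^ 2 = ((k ^ 2 : ℕ) : ℤ) + ((n ^ 2 : ℕ) : ℤ) - ((2 * n * k : ℕ) : ℤ) by
          push_cast; ring, zpow_sub₀ hs, zpow_add₀ hs]
        simp only [zpow_natCast]
        rw [pow_mul s (2 * n) k, inv_pow, div_eq_mul_inv]
      rw [e, zpow_sub₀ hw, mul_pow, inv_pow, zpow_natCast, zpow_natCast]
      ring

/-! ### Passage to the limit: Jacobi's triple product -/

lemma one_sub_pow_ne_zero {q : ℂ} (hq : ‖q‖ < 1) (n : ℕ) : 1 - q ^ (n + 1) ≠ 0 := by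
  intro h
  have : ‖q ^ (n + 1)‖ < 1 := by
    rw [norm_pow]; exact pow_lt_one₀ (norm_nonneg _) hq (by omega)
  rw [← sub_eq_zero.1 h] at this
  simp at this

lemma euler_ne_zero {q : ℂ} (hq : ‖q‖ < 1) : euler q ≠ 0 := by
  have := tprod_one_add_ne_zero_of_summable (f := fun n : ℕ => -q ^ (n + 1))
    (fun i => by simpa [← sub_eq_add_neg] using one_sub_pow_ne_zero hq i)
    (by simpa using (summable_nat_add_iff 1).mpr
          (summable_geometric_of_lt_one (norm_nonneg _) hq))
  simpa [euler, ← sub_eq_add_neg] using this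

lemma tendsto_qPoch {q : ℂ} (hq : ‖q‖ < 1) : Tendsto (qPoch q) atTop (𝓝 (euler q)) :=
  (ModularForm.multipliable_one_sub_pow hq).tendsto_prod_tprod_nat

lemma qPoch_ne_zero {q : ℂ} (hq : ‖q‖ < 1) (n : ℕ) : qPoch q n ≠ 0 :=
  prod_ne_zero_iff.2 fun i _ => one_sub_pow_ne_zero hq i

lemma qBinom_add {q : ℂ} (hq : ‖q‖ < 1) (j k : ℕ) :
    qBinom q (j + k) k = qPoch q (j + k) * (qPoch q j)⁻¹ * (qPoch q k)⁻¹ := by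
  have h1 := qPoch_ne_zero hq j
  have h2 := qPoch_ne_zero hq k
  field_simp
  linear_combination qBinom_add_mul q j k

/-- Both (q)ₙ and 1/(q)ₙ converge, hence are bounded. The uniform bound provides the dominating
series for the triple product. -/
lemma exists_norm_qBinom_le {q : ℂ} (hq : ‖q‖ < 1) :
    ∃ C : ℝ, 0 ≤ C ∧ ∀ n k, ‖qBinom q n k‖ ≤ C := by
  obtain ⟨A, hA⟩ := (tendsto_qPoch hq).norm.bddAbove_range
  obtain ⟨B, hB⟩ := ((tendsto_qPoch hq).inv₀ (euler_ne_zero hq)).norm.bddAbove_range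
  have hA' : ∀ n, ‖qPoch q n‖ ≤ A := fun n => hA ⟨n, rfl⟩
  have hB' : ∀ n, ‖(qPoch q n)⁻¹‖ ≤ B := fun n => hB ⟨n, rfl⟩
  have hA0 := (norm_nonneg _).trans (hA' 0)
  have hB0 := (norm_nonneg _).trans (hB' 0)
  refine ⟨A * B * B, by positivity, fun n k => ?_⟩
  rcases lt_or_ge n k with h | h
  · rw [qBinom_eq_zero q h, norm_zero]; positivity
  · obtain ⟨j, rfl⟩ := Nat.exists_eq_add_of_le' h
    rw [qBinom_add hq, norm_mul, norm_mul]
    gcongr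
    exacts [hA' _, hB' _, hB' _]

/-- Writing s = exp(πiτ), the condition ‖s‖ < 1 becomes Im τ > 0, the convergence criterion for the
two-variable Jacobi theta series. -/
lemma summable_zpow_sq_mul_zpow {s w : ℂ} (hs : s ≠ 0) (hs1 : ‖s‖ < 1) (hw : w ≠ 0) :
    Summable fun m : ℤ => s ^ (m ^ 2) * w ^ m := by
  have hpi : (Real.pi : ℂ) ≠ 0 := by exact_mod_cast Real.pi_ne_zero
  have hτ : 0 < (Complex.log s / (Real.pi * Complex.I)).im := by
    have : Complex.log s / (Real.pi * Complex.I) = ((Real.pi)⁻¹ : ℝ) * (-Complex.I * Complex.log s) := by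
      rw [Complex.ofReal_inv, div_eq_mul_inv, mul_inv, Complex.inv_I]; ring
    rw [this, Complex.im_ofReal_mul]
    have h2 : (-Complex.I * Complex.log s).im = -Real.log ‖s‖ := by simp [Complex.log_re]
    rw [h2]
    have := Real.log_neg (norm_pos_iff.2 hs) hs1
    have := Real.pi_pos
    apply mul_pos (by positivity); linarith
  refine ((summable_jacobiTheta₂_term_iff (Complex.log w / (2 * Real.pi * Complex.I)) _).2 hτ).congr
    fun m => ?_
  rw [jacobiTheta₂_term, Complex.exp_add, mul_comm]
  congr 1
  · rw [← Complex.exp_log hs, ← Complex.exp_int_mul, Complex.exp_log hs]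
    congr 1
    push_cast
    field_simp
  · rw [← Complex.exp_log hw, ← Complex.exp_int_mul, Complex.exp_log hw]
    congr 1
    field_simp

/-- Jacobi's triple product identity. -/
lemma hasSum_tripleProduct {s w A B : ℂ} (hs : s ≠ 0) (hs1 : ‖s‖ < 1) (hw : w ≠ 0)
    (hA : HasProd (fun i : ℕ => 1 + w * s ^ (2 * i + 1)) A)
    (hB : HasProd (fun i : ℕ => 1 + w⁻¹ * s ^ (2 * i + 1)) B) :
    HasSum (fun m : ℤ => s ^ (m ^ 2) * w ^ m) (euler (s ^ 2) * (A * B)) := by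
  have hq : ‖s ^ 2‖ < 1 := by rw [norm_pow]; exact pow_lt_one₀ (norm_nonneg _) hs1 (by omega)
  have hsum := summable_zpow_sq_mul_zpow hs hs1 hw
  obtain ⟨C, hC0, hC⟩ := exists_norm_qBinom_le hq
  -- The terms of the finite identity, indexed by m = k - n and extended by zero so that dominated
  -- convergence over ℤ applies.
  let f : ℕ → ℤ → ℂ := fun n m =>
    if m ∈ Finset.Icc (-(n : ℤ)) n then
      qBinom (s ^ 2) (2 * n) (m + n).toNat * (s ^ (m ^ 2) * w ^ m) else 0
  have hf : ∀ n, ∑' m, f n m = (∏ i ∈ range n, (1 + w * s ^ (2 * i + 1))) *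
      ∏ i ∈ range n, (1 + w⁻¹ * s ^ (2 * i + 1)) := by
    intro n
    rw [prod_mul_prod_eq_sum_qBinom hs hw, tsum_eq_sum (s := Finset.Icc (-(n : ℤ)) n)
      (fun m hm => if_neg hm)]
    refine sum_nbij' (fun m => (m + n).toNat) (fun k => (k : ℤ) - n) ?_ ?_ ?_ ?_ ?_
    · intro m hm; simp only [Finset.mem_Icc, mem_range] at hm ⊢; omega
    · intro k hk; simp only [Finset.mem_Icc, mem_range] at hk ⊢; omega
    · intro m hm; simp only [Finset.mem_Icc] at hm ⊢; omega
    · intro k hk; simp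
    · intro m hm
      have : (((m + n).toNat : ℕ) : ℤ) - n = m := by
        simp only [Finset.mem_Icc] at hm; omega
      simp only [if_pos hm, this]
  have hlim : ∀ m : ℤ, Tendsto (f · m) atTop
      (𝓝 ((euler (s ^ 2))⁻¹ * (s ^ (m ^ 2) * w ^ m))) := by
    intro m
    have hE := euler_ne_zero hq
    have t1 : Tendsto (fun n : ℕ => 2 * n) atTop atTop :=
      tendsto_atTop_mono (fun n => by simp only [id]; omega) tendsto_id
    have t2 : Tendsto (fun n : ℕ => (m + n).toNat) atTop atTop :=
      tendsto_atTop.2 fun b => by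
        filter_upwards [eventually_ge_atTop (b + m.natAbs)] with n hn; omega
    have t3 : Tendsto (fun n : ℕ => (n - m).toNat) atTop atTop :=
      tendsto_atTop.2 fun b => by
        filter_upwards [eventually_ge_atTop (b + m.natAbs)] with n hn; omega
    -- The coefficient is (q)₂ₙ / ((q)ₙ₋ₘ (q)ₙ₊ₘ) with q = s², which tends to 1/(q)_∞.
    have t := (((tendsto_qPoch hq).comp t1).mul (((tendsto_qPoch hq).comp t3).inv₀ hE)).mul
      (((tendsto_qPoch hq).comp t2).inv₀ hE)
    rw [mul_inv_cancel₀ hE, one_mul] at t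
    refine (t.mul_const _).congr' ?_
    filter_upwards [eventually_ge_atTop m.natAbs] with n hn
    have hm : m ∈ Finset.Icc (-(n : ℤ)) n := by simp only [Finset.mem_Icc]; omega
    have e : 2 * n = (n - m).toNat + (m + n).toNat := by omega
    simp only [f, if_pos hm, Function.comp]
    rw [e, qBinom_add hq]
  have hbd : ∀ n m, ‖f n m‖ ≤ C * ‖s ^ (m ^ 2) * w ^ m‖ := by
    intro n m
    simp only [f]
    split_ifs
    · rw [norm_mul]; gcongr; exact hC _ _
    · rw [norm_zero]; positivity
  have T := tendsto_tsum_of_dominated_convergence (hsum.norm.mul_left C) hlim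
    (Eventually.of_forall hbd)
  simp only [hf] at T
  have hAB := tendsto_nhds_unique T (hA.tendsto_prod_nat.mul hB.tendsto_prod_nat)
  rw [tsum_mul_left] at hAB
  rw [← hAB, mul_inv_cancel_left₀ (euler_ne_zero hq)]
  exact hsum.hasSum

/-! ### Power series on the unit disc -/

/-- The power series `F` converges to `f` on the open unit disc. -/
def ConvergesTo (F : PowerSeries ℂ) (f : ℂ → ℂ) : Prop :=
  ∀ z : ℂ, ‖z‖ < 1 → HasSum (fun n : ℕ => PowerSeries.coeff n F * z ^ n) (f z)

namespace ConvergesTo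

variable {F G : PowerSeries ℂ} {f g : ℂ → ℂ}

lemma congr (hF : ConvergesTo F f) (h : ∀ z, ‖z‖ < 1 → f z = g z) : ConvergesTo F g :=
  fun z hz => h z hz ▸ hF z hz

lemma add (hF : ConvergesTo F f) (hG : ConvergesTo G g) :
    ConvergesTo (F + G) fun z => f z + g z := fun z hz =>
  ((hF z hz).add (hG z hz)).congr_fun fun n => by simp [add_mul]

lemma mul (hF : ConvergesTo F f) (hG : ConvergesTo G g) :
    ConvergesTo (F * G) fun z => f z * g z := fun z hz => by
  have h1 := (hF z hz).summable.norm
  have h2 := (hG z hz).summable.norm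
  have h : (fun n => ∑ kl ∈ antidiagonal n, PowerSeries.coeff kl.1 F * z ^ kl.1 *
      (PowerSeries.coeff kl.2 G * z ^ kl.2)) =
      fun n => PowerSeries.coeff n (F * G) * z ^ n := by
    funext n
    rw [PowerSeries.coeff_mul, sum_mul]
    refine sum_congr rfl fun kl hkl => ?_
    rw [← mem_antidiagonal.1 hkl]
    ring
  have hs := (summable_norm_sum_mul_antidiagonal_of_summable_norm h1 h2).of_norm
  have ht := tsum_mul_tsum_eq_tsum_sum_antidiagonal_of_summable_norm h1 h2
  rw [h] at hs ht
  rw [(hF z hz).tsum_eq, (hG z hz).tsum_eq] at ht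
  simp only [ht]
  exact hs.hasSum

lemma const (c : ℂ) : ConvergesTo (PowerSeries.C c) fun _ => c := fun z _ => by
  have := hasSum_single (f := fun n : ℕ => PowerSeries.coeff n (PowerSeries.C c) * z ^ n) 0
    (fun n hn => by simp [PowerSeries.coeff_C, hn])
  simpa using this

lemma ofNat (n : ℕ) [n.AtLeastTwo] :
    ConvergesTo (ofNat(n) : PowerSeries ℂ) fun _ => (ofNat(n) : ℂ) := by
  have := const (ofNat(n) : ℂ)
  rwa [map_ofNat] at this

lemma one : ConvergesTo 1 fun _ => 1 := by simpa using const 1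

lemma pow (hF : ConvergesTo F f) (n : ℕ) : ConvergesTo (F ^ n) fun z => f z ^ n := by
  induction n with
  | zero => simpa using one
  | succ n ih => simpa only [pow_succ] using ih.mul hF

lemma aeval (hF : ConvergesTo F f) (p : Polynomial ℤ) :
    ConvergesTo (Polynomial.aeval F p) fun z => Polynomial.aeval (f z) p := by
  induction p using Polynomial.induction_on' with
  | add p q hp hq => simpa only [map_add] using hp.add hq
  | monomial n a =>
    simpa only [Polynomial.aeval_monomial, eq_intCast, map_intCast] using
      (const (a : ℂ)).mul (hF.pow n)

lemma substNeg (hF : ConvergesTo F f) :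
    ConvergesTo (substNeg F) fun z => f (-z) := fun z hz =>
  (hF (-z) (by simpa using hz)).congr_fun fun n => by
    rw [OverpartitionU2.substNeg, PowerSeries.evalNegHom, PowerSeries.coeff_rescale, neg_pow z]
    ring

lemma substSq (hF : ConvergesTo F f) :
    ConvergesTo (substSq F) fun z => f (z ^ 2) := fun z hz => by
  have h := hF (z ^ 2) (by rw [norm_pow]; exact pow_lt_one₀ (norm_nonneg _) hz two_ne_zero)
  rw [← (mul_right_injective₀ (two_ne_zero' ℕ)).hasSum_iff]
  · refine h.congr_fun fun n => ?_
    simp only [Function.comp]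
    rw [OverpartitionU2.substSq, PowerSeries.coeff_expand_mul, pow_mul]
  · intro n hn
    rw [OverpartitionU2.substSq, PowerSeries.coeff_expand_of_not_dvd, zero_mul]
    rintro ⟨m, rfl⟩
    exact hn ⟨m, rfl⟩

lemma atkinU_two (hF : ConvergesTo F f)
    (h : ∀ z, ‖z‖ < 1 → g (z ^ 2) = (f z + f (-z)) / 2) :
    ConvergesTo (atkinU 2 F) g := fun y hy => by
  -- Every point of the disc is a square z²; averaging the series at z and -z kills the odd terms.
  obtain ⟨z, rfl⟩ := IsAlgClosed.exists_pow_nat_eq y two_pos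
  have hz : ‖z‖ < 1 := by
    rw [norm_pow] at hy
    exact (pow_lt_one_iff_of_nonneg (norm_nonneg _) two_ne_zero).1 hy
  rw [h z hz]
  have hs := ((hF z hz).add (hF (-z) (by simpa using hz))).div_const 2
  rw [← (mul_right_injective₀ (two_ne_zero' ℕ)).hasSum_iff] at hs
  · refine hs.congr_fun fun n => ?_
    simp [atkinU, pow_mul]
  · intro n hn
    have : Odd n := by
      rw [← Nat.not_even_iff_odd, even_iff_two_dvd]
      rintro ⟨m, rfl⟩
      exact hn ⟨m, rfl⟩
    simp [this.neg_pow]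

lemma unique (hF : ConvergesTo F f) (hG : ConvergesTo G f) : F = G := by
  have key : ∀ {H : PowerSeries ℂ}, ConvergesTo H f →
      HasFPowerSeriesAt f (.ofScalars ℂ fun n => PowerSeries.coeff n H) 0 := by
    intro H hH
    rw [hasFPowerSeriesAt_iff]
    filter_upwards [Metric.ball_mem_nhds (0 : ℂ) one_pos] with z hz
    rw [zero_add]
    refine (hH z (by simpa using hz)).congr_fun fun n => ?_
    simp [FormalMultilinearSeries.coeff_ofScalars, mul_comm]
  ext n
  have := congrArg (fun p => p.coeff n) ((key hF).eq_formalMultilinearSeries (key hG))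
  simpa [FormalMultilinearSeries.coeff_ofScalars] using this

end ConvergesTo

lemma exists_convergesTo {f : ℂ → ℂ} (hf : DifferentiableOn ℂ f (Metric.ball 0 1)) :
    ∃ F, ConvergesTo F f :=
  ⟨.mk fun n => (n.factorial : ℂ)⁻¹ * iteratedDeriv n f 0, fun z hz => by
    simpa [mul_comm, mul_assoc, mul_left_comm] using
      Complex.hasSum_taylorSeries_on_ball hf (z := z) (by simpa using hz)⟩

/-- A function that vanishes at the rate forced by `f z = -2 f (z ^ 2)` vanishes identically. -/
lemma eq_zero_of_eq_neg_two_mul_sq {f : ℂ → ℂ} (hf : DifferentiableOn ℂ f (Metric.ball 0 1))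
    (h : ∀ z, ‖z‖ < 1 → f z = -2 * f (z ^ 2)) {z : ℂ} (hz : ‖z‖ < 1) : f z = 0 := by
  obtain ⟨F, hF⟩ := exists_convergesTo hf
  have e : F = PowerSeries.C (-2) * substSq F :=
    hF.unique (((ConvergesTo.const (-2)).mul hF.substSq).congr fun z hz => (h z hz).symm)
  have hc : ∀ n, PowerSeries.coeff n F = 0 := by
    intro n
    induction n using Nat.strong_induction_on with
    | _ n ih =>
      have en := congrArg (PowerSeries.coeff n) e
      rw [PowerSeries.coeff_C_mul, substSq] at en
      by_cases hd : 2 ∣ n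
      · obtain ⟨m, rfl⟩ := hd
        rw [PowerSeries.coeff_expand_mul] at en
        rcases Nat.eq_zero_or_pos m with rfl | hm
        · linear_combination en / 3
        · rw [en, ih m (by omega), mul_zero]
      · rw [en, PowerSeries.coeff_expand_of_not_dvd _ _ _ hd, mul_zero]
  have := hF z hz
  simp only [hc, zero_mul] at this
  exact this.unique hasSum_zero

/-! ### From functions on the upper half-plane to q-expansions -/

lemma norm_qParam_lt_one (τ : UpperHalfPlane) : ‖Function.Periodic.qParam 1 τ‖ < 1 :=
  Function.Periodic.norm_qParam_lt_one one_pos τ.im_pos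

/-- Off 0 the cusp function is g because `qParam` has a right inverse there; at 0 it is defined as a
limit, which continuity of g evaluates. -/
lemma convergesTo_qExpansion {f : UpperHalfPlane → ℂ} {g : ℂ → ℂ}
    (hg : DifferentiableOn ℂ g (Metric.ball 0 1))
    (h : ∀ τ : UpperHalfPlane, f τ = g (Function.Periodic.qParam 1 τ)) :
    ConvergesTo (UpperHalfPlane.qExpansion 1 f) g := by
  have h1 : Set.EqOn (UpperHalfPlane.cuspFunction 1 f) g (Metric.ball 0 1 \ {0}) := by
    rintro q ⟨hq, hq0⟩
    have hq : ‖q‖ < 1 := by simpa using hq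
    have hq0 : q ≠ 0 := hq0
    have hi := Function.Periodic.im_invQParam_pos_of_norm_lt_one one_pos hq hq0
    rw [UpperHalfPlane.cuspFunction, Function.Periodic.cuspFunction_eq_of_nonzero 1 _ hq0,
      Function.comp_apply, UpperHalfPlane.ofComplex_apply_of_im_pos hi, h]
    exact congrArg g (Function.Periodic.qParam_right_inv one_ne_zero hq0)
  have hnhds : Metric.ball (0 : ℂ) 1 ∈ 𝓝 0 := Metric.ball_mem_nhds _ one_pos
  have h0 : UpperHalfPlane.cuspFunction 1 f 0 = g 0 := by
    rw [UpperHalfPlane.cuspFunction, Function.Periodic.cuspFunction_zero_eq_limUnder_nhds_ne]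
    refine Tendsto.limUnder_eq ?_
    refine (((hg.differentiableAt hnhds).continuousAt.tendsto).mono_left
      nhdsWithin_le_nhds).congr' ?_
    filter_upwards [sdiff_mem_nhdsWithin_compl hnhds {0}] with q hq using (h1 hq).symm
  have h2 : Set.EqOn (UpperHalfPlane.cuspFunction 1 f) g (Metric.ball 0 1) := by
    intro q hq
    rcases eq_or_ne q 0 with rfl | hq0
    · exact h0
    · exact h1 ⟨hq, hq0⟩
  intro z hz
  have hz' : z ∈ Metric.ball (0 : ℂ) 1 := by simpa using hz
  rw [← h2 hz']
  simpa [UpperHalfPlane.qExpansion_coeff, mul_comm, mul_assoc, mul_left_comm] using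
    Complex.hasSum_taylorSeries_on_ball (hg.congr h2) hz'

lemma ConvergesTo.isQSeriesOf {F : PowerSeries ℂ} {f : UpperHalfPlane → ℂ} {g : ℂ → ℂ}
    (hF : ConvergesTo F g) (h : ∀ τ : UpperHalfPlane, f τ = g (Function.Periodic.qParam 1 τ)) :
    IsQSeriesOf F f := fun τ => by
  have := hF _ (norm_qParam_lt_one τ)
  rw [← h τ] at this
  simpa [Function.Periodic.qParam] using this

/-! ### Identities for the theta functions φ and ψ -/

lemma norm_pow_lt_one {z : ℂ} (hz : ‖z‖ < 1) {n : ℕ} (hn : n ≠ 0) : ‖z ^ n‖ < 1 := by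
  rw [norm_pow]; exact pow_lt_one₀ (norm_nonneg _) hz hn

lemma hasSum_int_even_add_odd {f : ℤ → ℂ} {a b : ℂ} (he : HasSum (fun m => f (2 * m)) a)
    (ho : HasSum (fun m => f (2 * m + 1)) b) : HasSum f (a + b) := by
  have h2 : Function.Injective fun m : ℤ => 2 * m := mul_right_injective₀ two_ne_zero
  have h3 : Function.Injective fun m : ℤ => 2 * m + 1 := (add_left_injective 1).comp h2
  refine (h2.hasSum_range_iff.2 he).add_isCompl ?_ (h3.hasSum_range_iff.2 ho)
  simpa using Int.isCompl_even_odd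

/-- The product `∏ (1 + z ^ n)` over the odd `n`. -/
noncomputable def oddProd (z : ℂ) : ℂ := ∏' n : ℕ, (1 + z ^ (2 * n + 1))

/-- The product `∏ (1 + z ^ n)`, `n ≥ 1`. -/
noncomputable def distinctProd (z : ℂ) : ℂ := ∏' n : ℕ, (1 + z ^ (n + 1))

/-- Ramanujan's theta function `φ` as an Euler product. -/
noncomputable def phi (z : ℂ) : ℂ := euler (-z) ^ 2 / euler (z ^ 2)

/-- Ramanujan's theta function `ψ` as an Euler product. -/
noncomputable def psi (z : ℂ) : ℂ := euler (z ^ 2) ^ 2 / euler z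

section

variable {z : ℂ} (hz : ‖z‖ < 1)
include hz

lemma multipliable_one_add_pow_succ : Multipliable fun n : ℕ => 1 + z ^ (n + 1) :=
  multipliable_one_add_of_summable <| by
    simpa using (summable_nat_add_iff 1).mpr (summable_geometric_of_lt_one (norm_nonneg _) hz)

lemma multipliable_one_add_pow_odd : Multipliable fun n : ℕ => 1 + z ^ (2 * n + 1) := by
  refine multipliable_one_add_of_summable ?_
  have h := (summable_geometric_of_lt_one (norm_nonneg z) hz).comp_injective
    (i := fun n : ℕ => 2 * n + 1) (fun a b h => by simp only at h; omega)
  simpa [Function.comp_def] using h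

lemma euler_eq_oddProd_mul : euler z = oddProd (-z) * euler (z ^ 2) := by
  have h1 := multipliable_one_add_pow_odd (z := -z) (by simpa using hz)
  have h2 := ModularForm.multipliable_one_sub_pow (norm_pow_lt_one hz two_ne_zero)
  have e1 : ∀ k : ℕ, 1 - z ^ (2 * k + 1) = 1 + (-z) ^ (2 * k + 1) := fun k => by
    rw [Odd.neg_pow ⟨k, rfl⟩]; ring
  have e2 : ∀ k : ℕ, 1 - z ^ (2 * k + 1 + 1) = 1 - (z ^ 2) ^ (k + 1) := fun k => by ring
  have := tprod_even_mul_odd (f := fun n : ℕ => 1 - z ^ (n + 1))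
    (by simpa only [e1] using h1) (by simpa only [e2] using h2)
  simp only [e1, e2] at this
  exact this.symm

lemma oddProd_mul_oddProd_neg : oddProd z * oddProd (-z) = oddProd (-z ^ 2) := by
  rw [oddProd, oddProd, oddProd, ← (multipliable_one_add_pow_odd hz).tprod_mul
    (multipliable_one_add_pow_odd (z := -z) (by simpa using hz))]
  refine tprod_congr fun n => ?_
  rw [Odd.neg_pow ⟨n, rfl⟩, Odd.neg_pow ⟨n, rfl⟩]
  ring

lemma distinctProd_mul_euler : distinctProd z * euler z = euler (z ^ 2) := by
  rw [distinctProd, euler, euler, ← (multipliable_one_add_pow_succ hz).tprod_mul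
    (ModularForm.multipliable_one_sub_pow hz)]
  exact tprod_congr fun n => by ring

/-- Split each Euler product into odd and even exponents: the odd parts of z and -z multiply to the
odd part of z². -/
lemma euler_mul_euler_neg : euler z * euler (-z) * euler (z ^ 4) = euler (z ^ 2) ^ 3 := by
  have h1 := euler_eq_oddProd_mul hz
  have h2 := euler_eq_oddProd_mul (z := -z) (by simpa using hz)
  have h3 := euler_eq_oddProd_mul (norm_pow_lt_one hz two_ne_zero)
  have h4 := oddProd_mul_oddProd_neg hz
  rw [neg_neg, neg_sq] at h2
  rw [← pow_mul] at h3
  norm_num at h3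
  rw [h1, h2, mul_mul_mul_comm, mul_comm (oddProd (-z)), h4]
  linear_combination -euler (z ^ 2) ^ 2 * h3

lemma phi_ne_zero : phi z ≠ 0 :=
  div_ne_zero (pow_ne_zero _ (euler_ne_zero (by simpa using hz)))
    (euler_ne_zero (norm_pow_lt_one hz two_ne_zero))

/-- This and `phi_mul_psi_sq` are both the square of `euler_mul_euler_neg`, after clearing
denominators. -/
lemma phi_mul_phi_neg : phi z * phi (-z) = phi (-z ^ 2) ^ 2 := by
  have h := euler_mul_euler_neg hz
  have h2 := euler_ne_zero (norm_pow_lt_one hz two_ne_zero)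
  have h4 := euler_ne_zero (norm_pow_lt_one hz (n := 4) (by norm_num))
  simp only [phi, neg_neg, neg_sq, ← pow_mul]
  norm_num
  field_simp
  linear_combination (euler z * euler (-z) * euler (z ^ 4) + euler (z ^ 2) ^ 3) * h

lemma phi_mul_psi_sq : phi z * psi (z ^ 2) = psi z ^ 2 := by
  have h := euler_mul_euler_neg hz
  have h1 := euler_ne_zero hz
  have h2 := euler_ne_zero (norm_pow_lt_one hz two_ne_zero)
  simp only [phi, psi, ← pow_mul]
  norm_num
  field_simp
  linear_combination (euler z * euler (-z) * euler (z ^ 4) + euler (z ^ 2) ^ 3) * h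

lemma hasSum_phi (hz0 : z ≠ 0) : HasSum (fun m : ℤ => z ^ (m ^ 2)) (phi z) := by
  have h := (multipliable_one_add_pow_odd hz).hasProd
  have := hasSum_tripleProduct hz0 hz one_ne_zero (by simpa using h) (by simpa using h)
  have e := euler_eq_oddProd_mul (z := -z) (by simpa using hz)
  have h2 := euler_ne_zero (norm_pow_lt_one hz two_ne_zero)
  rw [neg_neg, neg_sq] at e
  convert this using 1
  · simp
  · rw [phi, e, ← oddProd]
    field_simp

lemma hasSum_psi (hz0 : z ≠ 0) :
    HasSum (fun m : ℤ => z ^ (m ^ 2) * z ^ m) (2 * psi (z ^ 2)) := by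
  have hz2 := norm_pow_lt_one hz two_ne_zero
  have h := (multipliable_one_add_pow_succ hz2).hasProd
  -- At w = z the factors with w⁻¹ are 1 + z^(2i), starting at i = 0; that extra factor 1 + 1 is the
  -- 2 in front of ψ.
  have h' := HasProd.zero_mul (f := fun n : ℕ => 1 + (z ^ 2) ^ n) h
  have hA : HasProd (fun i : ℕ => 1 + z * z ^ (2 * i + 1)) (distinctProd (z ^ 2)) :=
    h.congr_fun fun i => by ring
  have hB : HasProd (fun i : ℕ => 1 + z⁻¹ * z ^ (2 * i + 1)) (2 * distinctProd (z ^ 2)) := by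
    convert h' using 1
    · funext i; rw [← pow_mul, pow_succ]; field_simp
    · rw [distinctProd]; norm_num
  have := hasSum_tripleProduct hz0 hz hz0 hA hB
  convert this using 1
  have e := distinctProd_mul_euler hz2
  have h2 := euler_ne_zero hz2
  rw [psi, ← e]
  field_simp

/-- The 2-dissection of `φ`. -/
lemma phi_eq_add : phi z = phi (z ^ 4) + 2 * z * psi (z ^ 8) := by
  rcases eq_or_ne z 0 with rfl | hz0
  · simp [phi]
  have h4 := norm_pow_lt_one hz (n := 4) (by norm_num)
  have h40 := pow_ne_zero 4 hz0
  have he := hasSum_phi h4 h40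
  have ho := (hasSum_psi h4 h40).mul_left z
  -- Even m gives exponent 4k², odd m gives 4(k² + k) + 1.
  have h := hasSum_int_even_add_odd (f := fun m : ℤ => z ^ (m ^ 2))
    (he.congr_fun fun m => ?_) (ho.congr_fun fun m => ?_)
  · rw [(hasSum_phi hz hz0).unique h]
    ring_nf
  · rw [← zpow_natCast z 4, ← zpow_mul]
    congr 1; push_cast; ring
  · rw [← zpow_natCast z 4, ← zpow_mul, ← zpow_mul, ← zpow_add₀ hz0, ← zpow_one_add₀ hz0]
    congr 1; push_cast; ring

lemma phi_add_phi_neg : phi z + phi (-z) = 2 * phi (z ^ 4) := by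
  rw [phi_eq_add hz, phi_eq_add (z := -z) (by simpa using hz)]
  rw [Even.neg_pow (by decide), Even.neg_pow (by decide)]
  ring

lemma phi_sq_sub_phi_neg_sq : phi z ^ 2 - phi (-z) ^ 2 = 8 * z * psi (z ^ 4) ^ 2 := by
  have h1 := phi_add_phi_neg hz
  have h2 : phi z - phi (-z) = 4 * z * psi (z ^ 8) := by
    rw [phi_eq_add hz, phi_eq_add (z := -z) (by simpa using hz)]
    rw [Even.neg_pow (by decide), Even.neg_pow (by decide)]
    ring
  have h3 := phi_mul_psi_sq (norm_pow_lt_one hz (n := 4) (by norm_num))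
  rw [← pow_mul] at h3
  norm_num at h3
  linear_combination (phi z - phi (-z)) * h1 + 2 * phi (z ^ 4) * h2 + 8 * z * h3

end

lemma differentiableOn_euler : DifferentiableOn ℂ euler (Metric.ball 0 1) :=
  ModularForm.differentiableOn_tprod_one_sub_pow

lemma differentiableOn_euler_pow {n : ℕ} (hn : n ≠ 0) :
    DifferentiableOn ℂ (fun z => euler (z ^ n)) (Metric.ball 0 1) :=
  differentiableOn_euler.comp (by fun_prop) fun z hz => by
    simpa using norm_pow_lt_one (by simpa using hz) hn

lemma differentiableOn_phi : DifferentiableOn ℂ phi (Metric.ball 0 1) := by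
  refine DifferentiableOn.div (DifferentiableOn.pow ?_ 2) (differentiableOn_euler_pow two_ne_zero)
    fun z hz => euler_ne_zero (norm_pow_lt_one (by simpa using hz) two_ne_zero)
  exact differentiableOn_euler.comp (by fun_prop) fun z hz => by simpa using hz

/-- The difference D of the two sides satisfies D(z) = -2D(z²), by the formulas for φ(z) + φ(-z) and
φ(z)φ(-z), so it vanishes. -/
lemma phi_sq_add_phi_neg_sq {z : ℂ} (hz : ‖z‖ < 1) :
    phi z ^ 2 + phi (-z) ^ 2 = 2 * phi (z ^ 2) ^ 2 := by
  have hd : DifferentiableOn ℂ (fun z => phi z ^ 2 + phi (-z) ^ 2 - 2 * phi (z ^ 2) ^ 2)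
      (Metric.ball 0 1) := by
    have h1 : DifferentiableOn ℂ (fun z => phi (-z)) (Metric.ball 0 1) :=
      differentiableOn_phi.comp (by fun_prop) fun z hz => by simpa using hz
    have h2 : DifferentiableOn ℂ (fun z => phi (z ^ 2)) (Metric.ball 0 1) :=
      differentiableOn_phi.comp (by fun_prop) fun z hz => by
        simpa using norm_pow_lt_one (by simpa using hz) two_ne_zero
    exact ((differentiableOn_phi.pow 2).add (h1.pow 2)).sub ((h2.pow 2).const_mul 2)
  refine sub_eq_zero.1 (eq_zero_of_eq_neg_two_mul_sq hd (fun z hz => ?_) hz)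
  have h1 := phi_add_phi_neg hz
  have h2 := phi_mul_phi_neg hz
  simp only [← pow_mul]
  norm_num
  linear_combination (phi z + phi (-z) + 2 * phi (z ^ 4)) * h1 - 2 * h2

/-! ### The eta-quotients in terms of φ(z) and φ(-z) -/

/-- The function `Φ₂` on the unit disc. -/
noncomputable def phi2Disc (z : ℂ) : ℂ := (phi (-z))⁻¹

/-- The function `G₂` on the unit disc. -/
noncomputable def g2Disc (z : ℂ) : ℂ :=
  phi z ^ 4 * (phi z ^ 4 - phi (-z) ^ 4) / (16 * phi (-z) ^ 8)

/-- The function `G₈` on the unit disc. -/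
noncomputable def g8Disc (z : ℂ) : ℂ := (phi z ^ 2 - phi (-z) ^ 2) / (8 * phi (-z) ^ 2)

lemma eta_natCast_mul (k : ℕ) (τ : UpperHalfPlane) :
    ModularForm.eta (k * τ) =
      Function.Periodic.qParam 24 τ ^ k * euler (Function.Periodic.qParam 1 τ ^ k) := by
  rw [ModularForm.eta, euler]
  congr 1
  · rw [Function.Periodic.qParam, Function.Periodic.qParam, ← Complex.exp_nat_mul]
    congr 1; ring
  · refine tprod_congr fun n => ?_
    rw [ModularForm.eta_q, Function.Periodic.qParam, Function.Periodic.qParam,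
      ← Complex.exp_nat_mul _ k]
    congr 4; ring

/-- The powers of exp(2πiτ/24) total 0 in `phi2` and 24 in `g2` and `g8`, which accounts for the
factor z in the latter two. -/
lemma qParam_pow_eq (τ : UpperHalfPlane) :
    Function.Periodic.qParam 24 τ ^ 24 = Function.Periodic.qParam 1 τ := by
  rw [Function.Periodic.qParam, Function.Periodic.qParam, ← Complex.exp_nat_mul]
  congr 1; push_cast; ring

lemma eta_eq (τ : UpperHalfPlane) : ModularForm.eta τ =
    Function.Periodic.qParam 24 τ * euler (Function.Periodic.qParam 1 τ) := by
  simpa using eta_natCast_mul 1 τ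

lemma eta_ofNat_mul (k : ℕ) [k.AtLeastTwo] (τ : UpperHalfPlane) :
    ModularForm.eta (ofNat(k) * τ) =
      Function.Periodic.qParam 24 τ ^ k * euler (Function.Periodic.qParam 1 τ ^ k) :=
  eta_natCast_mul k τ

lemma phi2Disc_eq (z : ℂ) : phi2Disc z = euler (z ^ 2) / euler z ^ 2 := by
  simp [phi2Disc, phi]

section

variable {z : ℂ} (hz : ‖z‖ < 1)
include hz

lemma g8Disc_eq :
    g8Disc z = z * (euler (z ^ 8) ^ 4 * euler (z ^ 2) ^ 2 / (euler (z ^ 4) ^ 2 * euler z ^ 4)) := by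
  have h1 := euler_ne_zero hz
  have h2 := euler_ne_zero (norm_pow_lt_one hz two_ne_zero)
  have h4 := euler_ne_zero (norm_pow_lt_one hz (n := 4) (by norm_num))
  rw [g8Disc, phi_sq_sub_phi_neg_sq hz]
  simp only [phi, psi, neg_neg, neg_sq, ← pow_mul]
  norm_num
  field_simp

lemma g2Disc_eq : g2Disc z = z * (euler (z ^ 2) / euler z) ^ 24 := by
  have h1 := euler_ne_zero hz
  have h2 := euler_ne_zero (norm_pow_lt_one hz two_ne_zero)
  have hb := phi_ne_zero (z := -z) (by simpa using hz)
  have e1 := phi_mul_psi_sq hz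
  have e2 := phi_mul_psi_sq (norm_pow_lt_one hz two_ne_zero)
  rw [← pow_mul] at e2
  norm_num at e2
  have e3 : phi z ^ 4 * (phi z ^ 4 - phi (-z) ^ 4) = 16 * z * psi z ^ 8 := by
    calc _ = phi z ^ 4 * ((phi z ^ 2 - phi (-z) ^ 2) * (phi z ^ 2 + phi (-z) ^ 2)) := by ring
      _ = 16 * z * (phi z * psi (z ^ 2)) ^ 4 := by
        rw [phi_sq_sub_phi_neg_sq hz, phi_sq_add_phi_neg_sq hz]
        linear_combination
          16 * z * phi z ^ 4 * (phi (z ^ 2) * psi (z ^ 4) + psi (z ^ 2) ^ 2) * e2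
      _ = _ := by rw [e1]; ring
  rw [g2Disc, e3]
  simp only [phi, psi, neg_neg, neg_sq]
  field_simp

/-- At z² the squares φ(z²)² and φ(-z²)² are the arithmetic mean of a², b² and the product ab. -/
lemma g8Disc_sq : g8Disc (z ^ 2) = (phi z - phi (-z)) ^ 2 / (16 * (phi z * phi (-z))) := by
  have ha := phi_ne_zero hz
  have hb := phi_ne_zero (z := -z) (by simpa using hz)
  have h1 := phi_sq_add_phi_neg_sq hz
  rw [g8Disc, ← phi_mul_phi_neg hz]
  field_simp
  linear_combination -8 * h1

lemma phi2Disc_neg_sq_sq : phi2Disc (-(z ^ 2) ^ 2) = 2 / (phi z + phi (-z)) := by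
  have h := phi_add_phi_neg hz
  have h4 := phi_ne_zero (norm_pow_lt_one hz (n := 4) (by norm_num))
  rw [phi2Disc, neg_neg, h, ← pow_mul]
  norm_num
  field_simp

lemma phi_add_phi_neg_ne_zero : phi z + phi (-z) ≠ 0 := by
  rw [phi_add_phi_neg hz]
  exact mul_ne_zero two_ne_zero (phi_ne_zero (norm_pow_lt_one hz (by norm_num)))

end

lemma differentiableOn_phi_neg : DifferentiableOn ℂ (fun z => phi (-z)) (Metric.ball 0 1) :=
  differentiableOn_phi.comp (by fun_prop) fun z hz => by simpa using hz

lemma phi_neg_ne_zero {z : ℂ} (hz : z ∈ Metric.ball (0 : ℂ) 1) : phi (-z) ≠ 0 :=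
  phi_ne_zero (by simpa using hz)

lemma differentiableOn_phi2Disc : DifferentiableOn ℂ phi2Disc (Metric.ball 0 1) :=
  differentiableOn_phi_neg.inv fun _ hz => phi_neg_ne_zero hz

lemma differentiableOn_g2Disc : DifferentiableOn ℂ g2Disc (Metric.ball 0 1) :=
  ((differentiableOn_phi.pow 4).mul ((differentiableOn_phi.pow 4).sub
    (differentiableOn_phi_neg.pow 4))).div ((differentiableOn_phi_neg.pow 8).const_mul 16)
    fun _ hz => mul_ne_zero (by norm_num) (pow_ne_zero _ (phi_neg_ne_zero hz))

lemma differentiableOn_g8Disc : DifferentiableOn ℂ g8Disc (Metric.ball 0 1) :=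
  ((differentiableOn_phi.pow 2).sub (differentiableOn_phi_neg.pow 2)).div
    ((differentiableOn_phi_neg.pow 2).const_mul 8)
    fun _ hz => mul_ne_zero (by norm_num) (pow_ne_zero _ (phi_neg_ne_zero hz))

lemma phi2_eq (τ : UpperHalfPlane) : phi2 τ = phi2Disc (Function.Periodic.qParam 1 τ) := by
  have hr : Function.Periodic.qParam 24 (τ : ℂ) ≠ 0 := Complex.exp_ne_zero _
  have hE := euler_ne_zero (norm_qParam_lt_one τ)
  rw [phi2Disc_eq, phi2, eta_eq, eta_ofNat_mul]
  field_simp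
  ring

lemma g2_eq (τ : UpperHalfPlane) : g2 τ = g2Disc (Function.Periodic.qParam 1 τ) := by
  have hr : Function.Periodic.qParam 24 (τ : ℂ) ≠ 0 := Complex.exp_ne_zero _
  rw [g2Disc_eq (norm_qParam_lt_one τ), g2, eta_eq, eta_ofNat_mul, ← qParam_pow_eq, ← mul_pow]
  congr 1
  rw [pow_two (Function.Periodic.qParam 24 (τ : ℂ)), mul_assoc, mul_div_mul_left _ _ hr,
    mul_div_assoc]

lemma g8_eq (τ : UpperHalfPlane) : g8 τ = g8Disc (Function.Periodic.qParam 1 τ) := by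
  have hq := norm_qParam_lt_one τ
  have hr : Function.Periodic.qParam 24 (τ : ℂ) ≠ 0 := Complex.exp_ne_zero _
  have h1 := euler_ne_zero hq
  have h4 := euler_ne_zero (norm_pow_lt_one hq (n := 4) (by norm_num))
  have e := qParam_pow_eq τ
  rw [g8Disc_eq hq, g8, eta_eq, eta_ofNat_mul, eta_ofNat_mul, eta_ofNat_mul]
  generalize Function.Periodic.qParam 24 (τ : ℂ) = r at *
  generalize euler (Function.Periodic.qParam 1 (τ : ℂ) ^ 4) = E4 at *
  generalize euler (Function.Periodic.qParam 1 (τ : ℂ) ^ 2) = E2 at *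
  generalize euler (Function.Periodic.qParam 1 (τ : ℂ) ^ 8) = E8 at *
  generalize euler (Function.Periodic.qParam 1 (τ : ℂ)) = E1 at *
  rw [← e]
  field_simp
  ring

lemma convergesTo_Phi2 : ConvergesTo Phi2 phi2Disc :=
  convergesTo_qExpansion differentiableOn_phi2Disc phi2_eq

lemma convergesTo_G2 : ConvergesTo G2 g2Disc :=
  convergesTo_qExpansion differentiableOn_g2Disc g2_eq

lemma convergesTo_G8 : ConvergesTo G8 g8Disc :=
  convergesTo_qExpansion differentiableOn_g8Disc g8_eq

/-! ### The four formulas for U₂ -/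

/-- An identity `F | U₂ = H` of power series is one between functions on the unit disc. -/
lemma atkinU_two_eq {F H : PowerSeries ℂ} {f h : ℂ → ℂ} (hF : ConvergesTo F f)
    (hH : ConvergesTo H h) (e : ∀ z, ‖z‖ < 1 → h (z ^ 2) = (f z + f (-z)) / 2) :
    atkinU 2 F = H :=
  (hF.atkinU_two e).unique hH

lemma atkinU_two_G8 : atkinU 2 G8 = 4 * G8 + 16 * G8 ^ 2 := by
  refine atkinU_two_eq convergesTo_G8 (((ConvergesTo.ofNat 4).mul convergesTo_G8).add
    ((ConvergesTo.ofNat 16).mul (convergesTo_G8.pow 2))) fun z hz => ?_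
  have ha := phi_ne_zero hz
  have hb := phi_ne_zero (z := -z) (by simpa using hz)
  simp only [g8Disc_sq hz]
  simp only [g8Disc, neg_neg]
  field_simp
  ring

lemma atkinU_two_Phi2 :
    atkinU 2 (substNeg Phi2) = (1 + 4 * G8) * substSq (substNeg Phi2) := by
  refine atkinU_two_eq convergesTo_Phi2.substNeg ((ConvergesTo.one.add
    ((ConvergesTo.ofNat 4).mul convergesTo_G8)).mul convergesTo_Phi2.substNeg.substSq)
    fun z hz => ?_
  have ha := phi_ne_zero hz
  have hb := phi_ne_zero (z := -z) (by simpa using hz)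
  have hab := phi_add_phi_neg_ne_zero hz
  simp only [g8Disc_sq hz, phi2Disc_neg_sq_sq hz]
  simp only [phi2Disc, neg_neg]
  field_simp
  ring

lemma atkinU_two_Phi2_mul_G8 : atkinU 2 (substNeg Phi2 * G8) =
    (2 * G8 + 8 * G8 ^ 2) * substSq (substNeg Phi2) := by
  refine atkinU_two_eq (convergesTo_Phi2.substNeg.mul convergesTo_G8)
    ((((ConvergesTo.ofNat 2).mul convergesTo_G8).add
    ((ConvergesTo.ofNat 8).mul (convergesTo_G8.pow 2))).mul convergesTo_Phi2.substNeg.substSq)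
    fun z hz => ?_
  have ha := phi_ne_zero hz
  have hb := phi_ne_zero (z := -z) (by simpa using hz)
  have hab := phi_add_phi_neg_ne_zero hz
  simp only [g8Disc_sq hz, phi2Disc_neg_sq_sq hz]
  simp only [phi2Disc, g8Disc, neg_neg]
  field_simp
  ring

/-- The even part is (a⁴ - b⁴)(a¹³ - b¹³)/(32a⁹b⁹). Divided by 2/(a + b) it is symmetric,
homogeneous of degree 0 and divisible by (a - b)², hence a polynomial of degree nine without
constant term in (a - b)²/(16ab). -/
lemma atkinU_two_Phi2_mul_G2 : atkinU 2 (substNeg Phi2 * substNeg G2) =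
    Polynomial.aeval G8 P * substSq (substNeg Phi2) := by
  refine atkinU_two_eq (convergesTo_Phi2.substNeg.mul convergesTo_G2.substNeg)
    ((convergesTo_G8.aeval P).mul convergesTo_Phi2.substNeg.substSq) fun z hz => ?_
  have ha := phi_ne_zero hz
  have hb := phi_ne_zero (z := -z) (by simpa using hz)
  have hab := phi_add_phi_neg_ne_zero hz
  simp only [g8Disc_sq hz, phi2Disc_neg_sq_sq hz]
  simp only [phi2Disc, g2Disc, neg_neg, P, map_add, map_mul, map_pow, Polynomial.aeval_X,
    Polynomial.aeval_C]
  generalize phi z = a at *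
  generalize phi (-z) = b at *
  norm_num
  field_simp
  ring

end OverpartitionU2

open OverpartitionU2 in
theorem mainTheorem5 :
    -- the three formal series are the `q`-series of the three eta-quotients
    (IsQSeriesOf Phi2 phi2 ∧ IsQSeriesOf G2 g2 ∧ IsQSeriesOf G8 g8) ∧
    -- the four formulas for the action of `U₂`; `substSq (substNeg Phi2)` is `Φ₂(-q²)`
    atkinU 2 G8 = 4 * G8 + 16 * G8 ^ 2 ∧
    atkinU 2 (substNeg Phi2) = (1 + 4 * G8) * substSq (substNeg Phi2) ∧
    atkinU 2 (substNeg Phi2 * G8) = (2 * G8 + 8 * G8 ^ 2) * substSq (substNeg Phi2) ∧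
    atkinU 2 (substNeg Phi2 * substNeg G2)
      = Polynomial.aeval G8 P * substSq (substNeg Phi2) :=
  ⟨⟨convergesTo_Phi2.isQSeriesOf phi2_eq, convergesTo_G2.isQSeriesOf g2_eq,
      convergesTo_G8.isQSeriesOf g8_eq⟩,
    atkinU_two_G8, atkinU_two_Phi2, atkinU_two_Phi2_mul_G8, atkinU_two_Phi2_mul_G2⟩
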